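/- Let $X$ be one of the Riemann surfaces $\mathbb{P}^1(\mathbb{C})$ (the Riemann sphere), $\mathbb{C}$, or $\mathbb{H}$ (the open upper half-plane), and let $\mathrm{Aut}(X)$ be the group of biholomorphic maps $X\to X$. A (cocompact) fuchsian group is a group isomorphic to a finitely generated subgroup $\Gamma$ of $\mathrm{Aut}(X)$, for one of these three $X$, such that $\Gamma$ acts properly discontinuously on $X$ and the quotient $X/\Gamma$ is compact. Every (cocompact) fuchsian group $G$ has a torsion-free normal subgroup of finite index; that is, there is a normal subgroup $N$ of finite index in $G$ such that the identity is the only element of $N$ of finite order. -/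

import Mathlib

open Filter Topology Manifold ContDiff

/-! ### The Riemann sphere `ℙ¹(ℂ) = ℂ ∪ {∞}` as a Riemann surface -/

namespace RiemannSphere

open scoped Classical in
/-- The inversion `z ↦ 1 / z` of `ℂ ∪ {∞}`, exchanging `0` and `∞`. -/
noncomputable def inversion : OnePoint ℂ → OnePoint ℂ
  | OnePoint.infty => ((0 : ℂ) : OnePoint ℂ)
  | OnePoint.some z => if z = 0 then OnePoint.infty else ((z⁻¹ : ℂ) : OnePoint ℂ)

theorem inversion_infty : inversion OnePoint.infty = ((0 : ℂ) : OnePoint ℂ) := rfl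

theorem inversion_zero : inversion ((0 : ℂ) : OnePoint ℂ) = OnePoint.infty := if_pos rfl

theorem inversion_coe {z : ℂ} (hz : z ≠ 0) :
    inversion (z : OnePoint ℂ) = ((z⁻¹ : ℂ) : OnePoint ℂ) := if_neg hz

theorem inversion_inversion (x : OnePoint ℂ) : inversion (inversion x) = x := by
  induction x using OnePoint.rec with
  | infty => rw [inversion_infty, inversion_zero]
  | coe z =>
    by_cases hz : z = 0
    · subst hz; rw [inversion_zero, inversion_infty]
    · rw [inversion_coe hz, inversion_coe (inv_ne_zero hz), inv_inv]

theorem continuous_inversion : Continuous inversion := by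
  rw [continuous_iff_continuousAt]
  intro x
  induction x using OnePoint.rec with
  | infty =>
    rw [OnePoint.continuousAt_infty', inversion_infty, coclosedCompact_eq_cocompact]
    have h : Tendsto (fun z : ℂ => ((z⁻¹ : ℂ) : OnePoint ℂ)) (cocompact ℂ)
        (𝓝 ((0 : ℂ) : OnePoint ℂ)) := by
      rw [← Metric.cobounded_eq_cocompact]
      exact (OnePoint.continuous_coe.tendsto (0 : ℂ)).comp tendsto_inv₀_cobounded
    refine h.congr' ?_
    have h0 : ∀ᶠ z : ℂ in cocompact ℂ, z ≠ 0 :=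
      isCompact_singleton.compl_mem_cocompact
    filter_upwards [h0] with z hz
    exact (inversion_coe hz).symm
  | coe z =>
    rw [OnePoint.continuousAt_coe]
    by_cases hz : z = 0
    · subst hz
      rw [continuousAt_iff_punctured_nhds, Function.comp_apply, inversion_zero]
      have h : Tendsto (fun z : ℂ => ((z⁻¹ : ℂ) : OnePoint ℂ)) (𝓝[≠] 0)
          (𝓝 OnePoint.infty) := by
        refine (OnePoint.tendsto_coe_infty (X := ℂ)).comp ?_
        rw [coclosedCompact_eq_cocompact, ← Metric.cobounded_eq_cocompact]
        exact tendsto_inv₀_nhdsNE_zero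
      refine h.congr' ?_
      filter_upwards [self_mem_nhdsWithin] with w hw
      exact (inversion_coe hw).symm
    · have h : ContinuousAt (fun w : ℂ => ((w⁻¹ : ℂ) : OnePoint ℂ)) z :=
        OnePoint.continuous_coe.continuousAt.comp (continuousAt_inv₀ hz)
      refine h.congr ?_
      filter_upwards [isOpen_ne.mem_nhds hz] with w hw
      exact (inversion_coe hw).symm

/-- The inversion `z ↦ 1 / z` as a homeomorphism of the sphere. -/
noncomputable def inversionHomeomorph : OnePoint ℂ ≃ₜ OnePoint ℂ where
  toFun := inversion
  invFun := inversion
  left_inv := inversion_inversion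
  right_inv := inversion_inversion
  continuous_toFun := continuous_inversion
  continuous_invFun := continuous_inversion

/-- The chart `z ↦ z` of the sphere, with domain `ℂ`. -/
noncomputable def chartZero : OpenPartialHomeomorph (OnePoint ℂ) ℂ :=
  ((OnePoint.isOpenEmbedding_coe (X := ℂ)).toOpenPartialHomeomorph _).symm

/-- The chart `z ↦ 1 / z` of the sphere, with domain the complement of `0`. -/
noncomputable def chartInfty : OpenPartialHomeomorph (OnePoint ℂ) ℂ :=
  inversionHomeomorph.toOpenPartialHomeomorph.trans chartZero

theorem mem_chartZero_source (z : ℂ) : (z : OnePoint ℂ) ∈ chartZero.source := by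
  simp [chartZero]

theorem infty_mem_chartInfty_source : OnePoint.infty ∈ chartInfty.source := by
  simp only [chartInfty, OpenPartialHomeomorph.trans_source]
  exact ⟨trivial, mem_chartZero_source 0⟩

open scoped Classical in
/-- The standard complex atlas of the Riemann sphere: the charts `z` and `1 / z`. -/
noncomputable instance : ChartedSpace ℂ (OnePoint ℂ) where
  atlas := {chartZero, chartInfty}
  chartAt x := if x = OnePoint.infty then chartInfty else chartZero
  mem_chart_source x := by
    induction x using OnePoint.rec with
    | infty => rw [if_pos rfl]; exact infty_mem_chartInfty_source
    | coe z => rw [if_neg (OnePoint.coe_ne_infty z)]; exact mem_chartZero_source z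
  chart_mem_atlas x := by
    split_ifs
    · exact Set.mem_insert_of_mem _ rfl
    · exact Set.mem_insert _ _

theorem transition_apply {z : ℂ} (hz : z ≠ 0) :
    (chartZero.symm.trans chartInfty) z = z⁻¹ := by
  change chartZero (inversion (z : OnePoint ℂ)) = _
  rw [inversion_coe hz]
  exact chartZero.right_inv (x := z⁻¹) trivial

/-- The two charts are holomorphically compatible. -/
instance : IsManifold 𝓘(ℂ) ω (OnePoint ℂ) := by
  have key : (chartZero.symm.trans chartInfty).source = {0}ᶜ := by
    ext z
    have : z ∈ (chartZero.symm.trans chartInfty).source ↔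
        inversion (z : OnePoint ℂ) ∈ chartZero.source := by
      simp only [OpenPartialHomeomorph.trans_source, chartInfty]
      constructor
      · rintro ⟨_, _, h⟩; exact h
      · intro h; exact ⟨trivial, trivial, h⟩
    rw [this]
    by_cases hz : z = 0
    · subst hz; simp [inversion_zero, chartZero]
    · rw [inversion_coe hz]; simp [hz, mem_chartZero_source]
  have sym : (chartInfty.symm.trans chartZero) = (chartZero.symm.trans chartInfty) := by
    have h : inversionHomeomorph.symm = inversionHomeomorph := rfl
    rw [chartInfty, OpenPartialHomeomorph.trans_symm_eq_symm_trans_symm,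
      OpenPartialHomeomorph.trans_assoc]
    rfl
  have hd : ContDiffOn ℂ ω (chartZero.symm.trans chartInfty)
      (chartZero.symm.trans chartInfty).source := by
    rw [key]
    refine ContDiffOn.congr (f := fun z => z⁻¹) ?_ (fun z hz => transition_apply hz)
    exact fun z hz => (contDiffAt_inv ℂ hz).contDiffWithinAt
  apply isManifold_of_contDiffOn
  intro e e' he he'
  simp only [modelWithCornersSelf_coe, modelWithCornersSelf_coe_symm, Function.comp_id,
    Function.id_comp, Set.range_id, Set.inter_univ, Set.preimage_id]
  have self : ∀ e : OpenPartialHomeomorph (OnePoint ℂ) ℂ, ContDiffOn ℂ ω (e.symm.trans e)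
      (e.symm.trans e).source := by
    intro e
    refine ContDiffOn.congr contDiffOn_id (fun z hz => ?_)
    exact e.right_inv (by simpa using hz.1)
  rcases he with rfl | rfl <;> rcases he' with rfl | rfl
  · exact self _
  · exact hd
  · rw [sym]; exact hd
  · exact self _

end RiemannSphere

/-! ### Fuchsian groups -/

/-- `Aut X`, the group of biholomorphic self-maps of the Riemann surface `X`. -/
def holomorphicAut (X : Type*) [TopologicalSpace X] [ChartedSpace ℂ X] :
    Subgroup (Equiv.Perm X) where
  carrier := {f | MDifferentiable 𝓘(ℂ) 𝓘(ℂ) (f : X → X) ∧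
    MDifferentiable 𝓘(ℂ) 𝓘(ℂ) (f.symm : X → X)}
  one_mem' := ⟨mdifferentiable_id, mdifferentiable_id⟩
  mul_mem' hf hg := ⟨hf.1.comp hg.1, hg.2.comp hf.2⟩
  inv_mem' hf := ⟨hf.2, hf.1⟩

/-- `Γ` is a finitely generated group of biholomorphic self-maps of `X` which acts properly
discontinuously on `X` and whose quotient `X / Γ` is compact. -/
structure IsCocompactDiscontinuous {X : Type*} [TopologicalSpace X] [ChartedSpace ℂ X]
    (Γ : Subgroup (Equiv.Perm X)) : Prop where
  le_aut : Γ ≤ holomorphicAut X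
  fg : Γ.FG
  properlyDiscontinuous : ProperlyDiscontinuousSMul Γ X
  compact_quotient : CompactSpace (MulAction.orbitRel.Quotient Γ X)

/-- A (cocompact) fuchsian group: a group isomorphic to a finitely generated, properly
discontinuous group of automorphisms, with compact quotient, of one of the simply connected
Riemann surfaces `ℙ¹(ℂ)`, `ℂ` and `ℍ`. -/
def IsFuchsianGroup (G : Type*) [Group G] : Prop :=
  (∃ Γ : Subgroup (Equiv.Perm (OnePoint ℂ)), IsCocompactDiscontinuous Γ ∧ Nonempty (G ≃* Γ)) ∨
  (∃ Γ : Subgroup (Equiv.Perm ℂ), IsCocompactDiscontinuous Γ ∧ Nonempty (G ≃* Γ)) ∨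
  (∃ Γ : Subgroup (Equiv.Perm UpperHalfPlane),
    IsCocompactDiscontinuous Γ ∧ Nonempty (G ≃* Γ))

/-- `N` is torsion-free: the only element of `N` of finite order is the identity. -/
def IsTorsionFreeSubgroup {G : Type*} [Group G] (N : Subgroup G) : Prop :=
  ∀ x ∈ N, IsOfFinOrder x → x = 1

/-! On the compact sphere, proper discontinuity forces the group to be finite, and the trivial
subgroup works. On ℂ and ℍ every automorphism is a Möbius map (Liouville, respectively the equality
case of Schwarz), so Γ is finitely generated and lifts, up to scalars ±1, to a finitely generated
subgroup of SL(2, ℂ).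

Selberg's lemma then applies. The matrix entries generate a domain `A` of finite type over ℤ, which
has many finite residue fields because ℤ is Jacobson. A matrix congruent to 1 modulo a maximal ideal
can only have torsion of the residue characteristic, so intersecting the congruence kernels for two
different residue characteristics removes all torsion. Since the lifts of the identity have square
1, torsion in Γ comes from torsion matrices, and the conclusion descends. -/

/-! ### Finite residue fields of domains of finite type over ℤ -/

theorem Int.isJacobsonRing : IsJacobsonRing ℤ := by
  rw [isJacobsonRing_iff_prime_eq]
  intro P hP
  by_cases hbot : P = ⊥
  · subst hbot
    refine le_antisymm (fun x hx => ?_) Ideal.le_jacobson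
    rw [Ideal.mem_jacobson_bot] at hx
    rw [Ideal.mem_bot]
    by_contra h0
    -- An element of the radical makes `x * y + 1` a unit for every `y`; here `3x² + 1 > 1`.
    have h1 := Int.isUnit_iff.1 (hx (3 * x))
    have h2 : 0 < x * x := mul_self_pos.2 h0
    rcases h1 with h1 | h1 <;> nlinarith
  · have := hP.isMaximal hbot
    exact Ideal.jacobson_eq_self_of_isMaximal

/-- By the Nullstellensatz over the Jacobson ring ℤ, `k` is a finite ℤ-module. In characteristic
zero, integrality would then make ℤ a field. -/
theorem Field.finite_of_finiteType_int (k : Type*) [Field k] [Algebra.FiniteType ℤ k] :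
    Finite k := by
  have := Int.isJacobsonRing
  have hfin : Module.Finite ℤ k := finite_of_finite_type_of_isJacobsonRing ℤ k
  rcases CharP.exists k with ⟨p, hp⟩
  rcases CharP.char_is_prime_or_zero k p with h | h
  · have : Fact p.Prime := ⟨h⟩
    let _ := ZMod.algebra k p
    have : IsScalarTower ℤ (ZMod p) k := IsScalarTower.of_algebraMap_eq' (RingHom.ext_int _ _)
    have : Module.Finite (ZMod p) k := Module.Finite.of_restrictScalars_finite ℤ (ZMod p) k
    exact Module.finite_of_finite (ZMod p)
  · subst h
    have : CharZero k := CharP.charP_to_charZero k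
    have hint : Algebra.IsIntegral ℤ k := inferInstance
    exact absurd (isField_of_isIntegral_of_isField (R := ℤ) (S := k)
      (FaithfulSMul.algebraMap_injective ℤ k) (Field.toIsField k)) Int.not_isField

/-- In a domain of finite type over `ℤ`, every nonzero element survives in a finite residue
field. -/
theorem Ideal.exists_isMaximal_finite_quotient_notMem {A : Type*} [CommRing A] [IsDomain A]
    [Algebra.FiniteType ℤ A] {a : A} (ha : a ≠ 0) :
    ∃ m : Ideal A, m.IsMaximal ∧ Finite (A ⧸ m) ∧ a ∉ m := by
  have := Int.isJacobsonRing
  have hA : IsJacobsonRing A := isJacobsonRing_of_finiteType (A := ℤ)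
  have hbot : (⊥ : Ideal A).jacobson = ⊥ :=
    isJacobsonRing_iff_prime_eq.1 hA ⊥ Ideal.isPrime_bot
  have h : a ∉ (⊥ : Ideal A).jacobson := by rw [hbot]; simpa using ha
  rw [Ideal.jacobson, Ideal.mem_sInf] at h
  push Not at h
  obtain ⟨m, ⟨-, hm⟩, ham⟩ := h
  refine ⟨m, hm, ?_, ham⟩
  have : Algebra.FiniteType ℤ (A ⧸ m) :=
    Algebra.FiniteType.of_surjective (Ideal.Quotient.mkₐ ℤ m) (Ideal.Quotient.mkₐ_surjective ℤ m)
  exact @Field.finite_of_finiteType_int (A ⧸ m) (Ideal.Quotient.field m) this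

/-! ### Selberg's lemma -/

/-- A matrix over a domain which is congruent to `1` modulo an ideal `m` has no `k`-torsion for
`k ∉ m`. -/
theorem Matrix.eq_one_of_pow_eq_one_of_map_eq_one {A n : Type*} [CommRing A] [IsDomain A]
    [Fintype n] [DecidableEq n] {m : Ideal A} [m.IsPrime] {k : ℕ} (hk : (k : A) ∉ m)
    {M : Matrix n n A} (hM : (Ideal.Quotient.mk m).mapMatrix M = 1) (hpow : M ^ k = 1) :
    M = 1 := by
  -- `S * (M - 1) = M ^ k - 1 = 0`, while `S` reduces to the scalar `k ≠ 0` modulo `m`; hence `det S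
  -- ≠ 0`, and the adjugate cancels `S`.
  set S := ∑ i ∈ Finset.range k, M ^ i with hS
  have hmap : (Ideal.Quotient.mk m).mapMatrix S = (k : Matrix n n (A ⧸ m)) := by
    rw [hS, map_sum]
    simp [map_pow, hM]
  have hdet : S.det ≠ 0 := by
    intro h0
    have h1 := RingHom.map_det (Ideal.Quotient.mk m) S
    rw [hmap, h0, map_zero, ← Matrix.diagonal_natCast, Matrix.det_diagonal,
      Finset.prod_const] at h1
    have h2 : ((k : ℕ) : A ⧸ m) = 0 := eq_zero_of_pow_eq_zero h1.symm
    exact hk (Ideal.Quotient.eq_zero_iff_mem.1 (by simpa using h2))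
  have hmul : S * (M - 1) = 0 := by rw [hS, geom_sum_mul, hpow, sub_self]
  have h3 : S.det • (M - 1) = 0 := by
    rw [← one_mul (M - 1), ← smul_mul_assoc, ← Matrix.adjugate_mul, mul_assoc, hmul, mul_zero]
  exact sub_eq_zero.1 ((smul_eq_zero.1 h3).resolve_left hdet)

/-- The principal congruence subgroup of a representation over `A`, for the ideal `m`. -/
def congruenceKernel {H A n : Type*} [Group H] [CommRing A] [Fintype n] [DecidableEq n]
    (ρ : H →* Matrix n n A) (m : Ideal A) : Subgroup H :=
  (((Ideal.Quotient.mk m).mapMatrix (m := n)).toMonoidHom.comp ρ).toHomUnits.ker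

section Congruence

variable {H A n : Type*} [Group H] [CommRing A] [Fintype n] [DecidableEq n]
    {ρ : H →* Matrix n n A} {m : Ideal A}

theorem mem_congruenceKernel {x : H} :
    x ∈ congruenceKernel ρ m ↔ (Ideal.Quotient.mk m).mapMatrix (ρ x) = 1 := by
  rw [congruenceKernel, MonoidHom.mem_ker, Units.ext_iff]
  rfl

instance congruenceKernel_normal : (congruenceKernel ρ m).Normal := by
  unfold congruenceKernel; infer_instance

theorem congruenceKernel_finiteIndex [Finite (A ⧸ m)] : (congruenceKernel ρ m).FiniteIndex := by
  unfold congruenceKernel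
  have : Finite (Matrix n n (A ⧸ m)) := by unfold Matrix; infer_instance
  infer_instance

/-- **Selberg's lemma** over a domain of finite type over `ℤ`. -/
theorem exists_normal_finiteIndex_of_finiteType [IsDomain A] [CharZero A]
    [Algebra.FiniteType ℤ A] (ρ : H →* Matrix n n A) :
    ∃ N : Subgroup H, N.Normal ∧ N.FiniteIndex ∧
      ∀ x ∈ N, IsOfFinOrder (ρ x) → ρ x = 1 := by
  obtain ⟨m₁, hm₁, hfin₁, -⟩ :=
    Ideal.exists_isMaximal_finite_quotient_notMem (one_ne_zero (α := A))
  obtain ⟨p, hp⟩ := CharP.exists (A ⧸ m₁)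
  let _ := Ideal.Quotient.field m₁
  have hp0 : p ≠ 0 := CharP.char_ne_zero_of_finite (A ⧸ m₁) p
  have hpp : p.Prime := (CharP.char_is_prime_or_zero (A ⧸ m₁) p).resolve_right hp0
  -- Avoiding `p`, the residue characteristic of `m₁`, makes that of `m₂` different.
  obtain ⟨m₂, hm₂, hfin₂, hpm₂⟩ := Ideal.exists_isMaximal_finite_quotient_notMem
    (a := (p : A)) (by exact_mod_cast hp0)
  have := congruenceKernel_finiteIndex (ρ := ρ) (m := m₁)
  have := congruenceKernel_finiteIndex (ρ := ρ) (m := m₂)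
  refine ⟨congruenceKernel ρ m₁ ⊓ congruenceKernel ρ m₂, inferInstance, inferInstance, ?_⟩
  intro x hx hfin
  by_contra hne
  -- The power `x ^ r` has image of prime order `q`. Either `q ∉ m₁`, or `q = p ∉ m₂`.
  obtain ⟨q, hq, r, hr⟩ := Nat.exists_prime_and_dvd (n := orderOf (ρ x))
    (by rwa [Ne, orderOf_eq_one_iff])
  have hpos : 0 < orderOf (ρ x) := hfin.orderOf_pos
  have hr0 : 0 < r := Nat.pos_of_ne_zero (by rintro rfl; simp [hr] at hpos)
  have hrlt : r < orderOf (ρ x) := by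
    rw [hr]; exact lt_mul_of_one_lt_left hr0 hq.one_lt
  have hy : x ^ r ∈ congruenceKernel ρ m₁ ⊓ congruenceKernel ρ m₂ := pow_mem hx r
  have hpow : ρ (x ^ r) ^ q = 1 := by
    rw [map_pow, ← pow_mul, mul_comm, ← hr, pow_orderOf_eq_one]
  have hyne : ρ (x ^ r) ≠ 1 := by
    rw [map_pow]; exact pow_ne_one_of_lt_orderOf hr0.ne' hrlt
  by_cases hq₁ : (q : A) ∈ m₁
  · have hq0 : ((q : ℕ) : A ⧸ m₁) = 0 := by
      simpa using Ideal.Quotient.eq_zero_iff_mem.2 hq₁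
    have hpq : p = q := (Nat.prime_dvd_prime_iff_eq hpp hq).1
      ((CharP.cast_eq_zero_iff (A ⧸ m₁) p q).1 hq0)
    subst hpq
    exact hyne (Matrix.eq_one_of_pow_eq_one_of_map_eq_one hpm₂
      (mem_congruenceKernel.1 hy.2) hpow)
  · exact hyne (Matrix.eq_one_of_pow_eq_one_of_map_eq_one hq₁
      (mem_congruenceKernel.1 hy.1) hpow)

end Congruence

/-- **Selberg's lemma**: a finitely generated linear group in characteristic zero is virtually
torsion-free. -/
theorem exists_normal_finiteIndex_of_fg {H K n : Type*} [Group H] [Group.FG H] [Field K]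
    [CharZero K] [Fintype n] [DecidableEq n] (ρ : H →* Matrix n n K) :
    ∃ N : Subgroup H, N.Normal ∧ N.FiniteIndex ∧
      ∀ x ∈ N, IsOfFinOrder (ρ x) → ρ x = 1 := by
  obtain ⟨S, hS⟩ := Group.FG.out (G := H)
  -- Entries of inverses are included so that `A` contains the entries of the whole image of `ρ`.
  let E : Set K := ⋃ s ∈ S, ⋃ i : n, ⋃ j : n, {ρ s i j, ρ s⁻¹ i j}
  have hE : E.Finite :=
    S.finite_toSet.biUnion fun s _ => Set.finite_iUnion fun i => Set.finite_iUnion fun j =>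
      Set.toFinite _
  let A := Algebra.adjoin ℤ E
  have hAft : Algebra.FiniteType ℤ A :=
    A.fg_iff_finiteType.1 (Subalgebra.fg_def.2 ⟨E, hE, rfl⟩)
  let φ : Matrix n n A →+* Matrix n n K := A.toSubring.subtype.mapMatrix
  have hφ : Function.Injective φ := fun M M' h => by
    ext i j
    exact congrFun (congrFun h i) j
  have hrange : ∀ x : H, ρ x ∈ MonoidHom.mrange φ.toMonoidHom := by
    have hgen : ∀ M : Matrix n n K, (∀ i j, M i j ∈ A) →
        M ∈ MonoidHom.mrange φ.toMonoidHom := fun M hM =>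
      ⟨Matrix.of fun i j => ⟨M i j, hM i j⟩, by ext i j; rfl⟩
    intro x
    have hx : x ∈ Subgroup.closure (S : Set H) := by rw [hS]; trivial
    induction hx using Subgroup.closure_induction'' with
    | one => rw [map_one]; exact one_mem _
    | mem s hs =>
      refine hgen _ fun i j => Algebra.subset_adjoin ?_
      simp only [E, Set.mem_iUnion]
      exact ⟨s, hs, i, j, by simp⟩
    | inv_mem s hs =>
      refine hgen _ fun i j => Algebra.subset_adjoin ?_
      simp only [E, Set.mem_iUnion]
      exact ⟨s, hs, i, j, by simp⟩
    | mul x y _ _ hx hy => rw [map_mul]; exact mul_mem hx hy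
  choose σ hσ using hrange
  let ρA : H →* Matrix n n A :=
    { toFun := σ
      map_one' := hφ (by rw [map_one]; exact (hσ 1).trans (map_one ρ))
      map_mul' := fun x y => hφ (by
        rw [map_mul]
        exact (hσ (x * y)).trans ((map_mul ρ x y).trans
          (congrArg₂ (· * ·) (hσ x).symm (hσ y).symm))) }
  have hρA : ∀ x, φ (ρA x) = ρ x := hσ
  obtain ⟨N, hN, hNf, hNt⟩ := exists_normal_finiteIndex_of_finiteType ρA
  refine ⟨N, hN, hNf, fun x hx hfin => ?_⟩
  have h1 : IsOfFinOrder (ρA x) := by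
    rw [← hρA] at hfin
    exact (Function.Injective.isOfFinOrder_iff (f := φ.toMonoidHom) hφ).1 hfin
  rw [← hρA, hNt x hx h1, map_one]

/-! ### Automorphisms of the upper half-plane -/

/-- `z ↦ (z - p) / (z - p̄)`, mapping the upper half-plane to the unit disk if `0 < p.im`. -/
noncomputable def cayley (p z : ℂ) : ℂ := (z - p) / (z - starRingEnd ℂ p)

/-- The inverse of `cayley p`. -/
noncomputable def cayleySymm (p ζ : ℂ) : ℂ := (p - starRingEnd ℂ p * ζ) / (1 - ζ)

theorem sub_conj_ne_zero {p z : ℂ} (hp : 0 < p.im) (hz : 0 < z.im) :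
    z - starRingEnd ℂ p ≠ 0 := by
  intro h
  have := congrArg Complex.im h
  simp at this
  linarith

theorem one_sub_ne_zero_of_norm_lt_one {ζ : ℂ} (hζ : ‖ζ‖ < 1) : 1 - ζ ≠ 0 := by
  intro h
  rw [← sub_eq_zero.1 h] at hζ
  simp at hζ

theorem norm_cayley_lt_one {p z : ℂ} (hp : 0 < p.im) (hz : 0 < z.im) : ‖cayley p z‖ < 1 := by
  rw [cayley, norm_div, div_lt_one (norm_pos_iff.2 (sub_conj_ne_zero hp hz)),
    ← sq_lt_sq₀ (norm_nonneg _) (norm_nonneg _), ← Complex.normSq_eq_norm_sq,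
    ← Complex.normSq_eq_norm_sq, Complex.normSq_apply, Complex.normSq_apply]
  simp only [Complex.sub_re, Complex.sub_im, Complex.conj_re, Complex.conj_im]
  nlinarith [mul_pos hp hz]

theorem cayleySymm_im_pos {p ζ : ℂ} (hp : 0 < p.im) (hζ : ‖ζ‖ < 1) :
    0 < (cayleySymm p ζ).im := by
  have h1 : 0 < Complex.normSq (1 - ζ) :=
    Complex.normSq_pos.2 (one_sub_ne_zero_of_norm_lt_one hζ)
  have h2 : ζ.re * ζ.re + ζ.im * ζ.im < 1 := by
    rw [← Complex.normSq_apply, Complex.normSq_eq_norm_sq]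
    exact pow_lt_one₀ (norm_nonneg _) hζ two_ne_zero
  have h3 : (cayleySymm p ζ).im =
      p.im * (1 - (ζ.re * ζ.re + ζ.im * ζ.im)) / Complex.normSq (1 - ζ) := by
    rw [cayleySymm, Complex.div_im, ← sub_div]
    congr 1
    simp
    ring
  rw [h3]
  exact div_pos (mul_pos hp (by linarith)) h1

theorem cayley_cayleySymm {p ζ : ℂ} (hp : 0 < p.im) (hζ : ‖ζ‖ < 1) :
    cayley p (cayleySymm p ζ) = ζ := by
  have h1 := one_sub_ne_zero_of_norm_lt_one hζ
  have h2 := sub_conj_ne_zero hp (cayleySymm_im_pos hp hζ)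
  rw [cayley, div_eq_iff h2, cayleySymm]
  field_simp
  ring

theorem cayleySymm_cayley {p z : ℂ} (hp : 0 < p.im) (hz : 0 < z.im) :
    cayleySymm p (cayley p z) = z := by
  have h1 := one_sub_ne_zero_of_norm_lt_one (norm_cayley_lt_one hp hz)
  have h2 := sub_conj_ne_zero hp hz
  rw [cayleySymm, div_eq_iff h1, cayley]
  field_simp
  ring

/-- The self-map of the unit disk fixing `0` which corresponds to `f : ℍ → ℍ` under Cayley
transforms centred at `p` and `f p`. -/
noncomputable def diskConj (f : UpperHalfPlane → UpperHalfPlane) (p : UpperHalfPlane) (ζ : ℂ) : ℂ :=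
  cayley (f p) (f (UpperHalfPlane.ofComplex (cayleySymm p ζ)))

section DiskConj

variable {f : UpperHalfPlane → UpperHalfPlane} {p : UpperHalfPlane}

theorem norm_diskConj_lt_one (ζ : ℂ) : ‖diskConj f p ζ‖ < 1 :=
  norm_cayley_lt_one (UpperHalfPlane.im_pos _) (UpperHalfPlane.im_pos _)

theorem diskConj_cayley (z : UpperHalfPlane) : diskConj f p (cayley p z) = cayley (f p) (f z) := by
  rw [diskConj, cayleySymm_cayley p.im_pos z.im_pos, UpperHalfPlane.ofComplex_apply]

theorem diskConj_zero : diskConj f p 0 = 0 := by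
  have h := diskConj_cayley (f := f) (p := p) p
  simpa [cayley] using h

theorem differentiableOn_diskConj (hf : MDifferentiable 𝓘(ℂ) 𝓘(ℂ) f) :
    DifferentiableOn ℂ (diskConj f p) (Metric.ball 0 1) := by
  have h1 : DifferentiableOn ℂ (fun z => ((f (UpperHalfPlane.ofComplex z) : UpperHalfPlane) : ℂ))
      {z | 0 < z.im} :=
    UpperHalfPlane.mdifferentiable_iff.1 (UpperHalfPlane.mdifferentiable_coe.comp hf)
  have h2 : DifferentiableOn ℂ (cayleySymm p) (Metric.ball 0 1) := by
    refine DifferentiableOn.div (by fun_prop) (by fun_prop) fun ζ hζ => ?_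
    exact one_sub_ne_zero_of_norm_lt_one (by simpa using hζ)
  have h3 := h1.comp h2 fun ζ hζ => cayleySymm_im_pos p.im_pos (by simpa using hζ)
  exact DifferentiableOn.div (h3.sub_const _) (h3.sub_const _) fun ζ _ =>
    sub_conj_ne_zero (UpperHalfPlane.im_pos _) (UpperHalfPlane.im_pos _)

theorem norm_diskConj_le (hf : MDifferentiable 𝓘(ℂ) 𝓘(ℂ) f) {ζ : ℂ} (hζ : ‖ζ‖ < 1) :
    ‖diskConj f p ζ‖ ≤ ‖ζ‖ := by
  have h := Complex.dist_le_dist_of_mapsTo_ball (differentiableOn_diskConj (p := p) hf)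
    (fun z _ => by
      rw [diskConj_zero, mem_closedBall_zero_iff]
      exact (norm_diskConj_lt_one z).le)
    (mem_ball_zero_iff.2 hζ)
  simpa [diskConj_zero] using h

end DiskConj

/-- An automorphism of the upper half-plane is a rotation in Cayley coordinates. -/
theorem exists_cayley_eq_const_mul {f : Equiv.Perm UpperHalfPlane}
    (hf : f ∈ holomorphicAut UpperHalfPlane) (p : UpperHalfPlane) :
    ∃ C : ℂ, C ≠ 0 ∧ ∀ z : UpperHalfPlane, cayley (f p) (f z) = C * cayley p z := by
  -- Schwarz's lemma for `f` and for its inverse gives both inequalities.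
  have hnorm : ∀ z : UpperHalfPlane, ‖cayley (f p) (f z)‖ = ‖cayley p z‖ := by
    intro z
    refine le_antisymm ?_ ?_
    · rw [← diskConj_cayley]
      exact norm_diskConj_le hf.1 (norm_cayley_lt_one p.im_pos z.im_pos)
    · have h := norm_diskConj_le (f := f.symm) (p := f p) hf.2
        (norm_cayley_lt_one (f p).im_pos (f z).im_pos)
      rwa [diskConj_cayley, f.symm_apply_apply, f.symm_apply_apply] at h
  have hhalf : ‖(1 / 2 : ℂ)‖ < 1 := by norm_num
  -- Equality in Schwarz's lemma at one nonzero point, here `1 / 2`, forces linearity.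
  have hslope : ‖dslope (diskConj f p) 0 (1 / 2)‖ = 1 / 1 := by
    have h := hnorm ⟨cayleySymm p (1 / 2), cayleySymm_im_pos p.im_pos hhalf⟩
    rw [← diskConj_cayley] at h
    simp only at h
    rw [cayley_cayleySymm p.im_pos hhalf] at h
    rw [dslope_of_ne _ (by norm_num), slope_def_field, diskConj_zero, norm_div, sub_zero, h]
    norm_num
  have haff := Complex.affine_of_mapsTo_ball_of_norm_dslope_eq_div
    (differentiableOn_diskConj (p := p) hf.1) (R₁ := 1) (R₂ := 1)
    (fun z _ => by
      rw [diskConj_zero, mem_closedBall_zero_iff]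
      exact (norm_diskConj_lt_one z).le)
    (mem_ball_zero_iff.2 hhalf) hslope
  refine ⟨dslope (diskConj f p) 0 (1 / 2), ?_, fun z => ?_⟩
  · rw [← norm_pos_iff, hslope]; norm_num
  · have h := haff (mem_ball_zero_iff.2 (norm_cayley_lt_one p.im_pos z.im_pos))
    rw [diskConj_cayley] at h
    simpa [diskConj_zero, mul_comm] using h

theorem exists_mobius_of_mem_holomorphicAut_upperHalfPlane {f : Equiv.Perm UpperHalfPlane}
    (hf : f ∈ holomorphicAut UpperHalfPlane) :
    ∃ a b c d : ℂ, a * d - b * c ≠ 0 ∧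
      ∀ z : UpperHalfPlane, (f z : ℂ) * (c * z + d) = a * z + b := by
  obtain ⟨C, hC, h⟩ := exists_cayley_eq_const_mul hf UpperHalfPlane.I
  set p : ℂ := ((UpperHalfPlane.I : UpperHalfPlane) : ℂ)
  set w : ℂ := ((f UpperHalfPlane.I : UpperHalfPlane) : ℂ)
  have hp : p - starRingEnd ℂ p ≠ 0 :=
    sub_conj_ne_zero UpperHalfPlane.I.im_pos UpperHalfPlane.I.im_pos
  have hw : w - starRingEnd ℂ w ≠ 0 :=
    sub_conj_ne_zero (UpperHalfPlane.im_pos _) (UpperHalfPlane.im_pos _)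
  -- Coefficients read off from `(f z - w)(z - p̄) = C (z - p)(f z - w̄)`.
  refine ⟨w - C * starRingEnd ℂ w, C * p * starRingEnd ℂ w - w * starRingEnd ℂ p,
    1 - C, C * p - starRingEnd ℂ p, ?_, fun z => ?_⟩
  · have : (w - C * starRingEnd ℂ w) * (C * p - starRingEnd ℂ p) -
        (C * p * starRingEnd ℂ w - w * starRingEnd ℂ p) * (1 - C) =
        C * (p - starRingEnd ℂ p) * (w - starRingEnd ℂ w) := by ring
    rw [this]
    exact mul_ne_zero (mul_ne_zero hC hp) hw
  · have h1 : (f z : ℂ) - starRingEnd ℂ w ≠ 0 :=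
      sub_conj_ne_zero (UpperHalfPlane.im_pos _) (UpperHalfPlane.im_pos _)
    have h2 : (z : ℂ) - starRingEnd ℂ p ≠ 0 :=
      sub_conj_ne_zero UpperHalfPlane.I.im_pos z.im_pos
    have h3 := h z
    rw [cayley, cayley, div_eq_iff h1] at h3
    field_simp at h3
    linear_combination h3

/-! ### Automorphisms of the plane -/

/-- Being a homeomorphism, `f` is proper. Its inverse therefore extends holomorphically to infinity,
which yields `f z = O(z)`; so `f z / z` is entire and bounded, hence constant by Liouville. -/
theorem exists_eq_mul_of_mem_holomorphicAut_of_map_zero {f : Equiv.Perm ℂ}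
    (hf : f ∈ holomorphicAut ℂ) (h0 : f 0 = 0) : ∃ a : ℂ, ∀ z, f z = a * z := by
  have hfd : Differentiable ℂ f := hf.1.differentiable
  have hgd : Differentiable ℂ f.symm := hf.2.differentiable
  let e : ℂ ≃ₜ ℂ := ⟨f, hfd.continuous, hgd.continuous⟩
  have hg0 : f.symm 0 = 0 := by rw [Equiv.symm_apply_eq, h0]
  have hft : Tendsto f (cocompact ℂ) (cocompact ℂ) := e.map_cocompact.le
  have hgt : Tendsto f.symm (cocompact ℂ) (cocompact ℂ) := e.symm.map_cocompact.le
  rw [← Metric.cobounded_eq_cocompact] at hft hgt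
  -- The inverse of `f` in the coordinate `1 / w` at infinity; the convention `0⁻¹ = 0` gives the
  -- right value at the removable singularity.
  set k : ℂ → ℂ := fun w => (f.symm w⁻¹)⁻¹ with hk
  have hk0 : k 0 = 0 := by simp [hk, hg0]
  have hkd : DifferentiableAt ℂ k 0 := by
    refine (Complex.analyticAt_of_differentiable_on_punctured_nhds_of_continuousAt ?_ ?_).differentiableAt
    · filter_upwards [self_mem_nhdsWithin] with w hw
      refine (hgd.differentiableAt.comp w (differentiableAt_inv hw)).inv fun h => ?_
      rw [Function.comp_apply, Equiv.symm_apply_eq, h0] at h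
      exact hw (inv_eq_zero.1 h)
    · rw [continuousAt_iff_punctured_nhds, hk0]
      exact tendsto_inv₀_cobounded.comp (hgt.comp tendsto_inv₀_nhdsNE_zero)
  have hO : f =O[Bornology.cobounded ℂ] (fun z : ℂ => z) := by
    have h1 : k =O[𝓝 0] fun w => w := by simpa [hk0] using hkd.isBigO_sub
    -- Put `w = 1 / f z`, for which `k w = 1 / z`.
    have h2 := h1.comp_tendsto (tendsto_inv₀_cobounded.comp hft)
    have h3 : (fun z : ℂ => z⁻¹) =O[Bornology.cobounded ℂ] fun z => (f z)⁻¹ := by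
      refine h2.congr (fun z => ?_) fun z => rfl
      simp [hk]
    have h4 := h3.inv_rev (Eventually.of_forall fun z hz => by
      rw [inv_eq_zero.1 hz, h0, inv_zero])
    simpa using h4
  have hd : Differentiable ℂ (dslope f 0) := by
    rw [← differentiableOn_univ, Complex.differentiableOn_dslope univ_mem]
    exact hfd.differentiableOn
  have hb : Bornology.IsBounded (Set.range (dslope f 0)) := by
    obtain ⟨c, hc⟩ := hO.bound
    rw [Metric.cobounded_eq_cocompact] at hc
    obtain ⟨K, hK, hKc⟩ := mem_cocompact.1 hc
    refine ((hK.image hd.continuous).isBounded.union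
      ((Metric.isBounded_closedBall (x := (0 : ℂ)) (r := c)).union
        (Bornology.isBounded_singleton (x := dslope f 0 0)))).subset ?_
    rintro _ ⟨z, rfl⟩
    by_cases hz : z ∈ K
    · exact Or.inl ⟨z, hz, rfl⟩
    · right
      rcases eq_or_ne z 0 with rfl | hz0
      · exact Or.inr rfl
      · left
        have hle : ‖f z‖ ≤ c * ‖z‖ := hKc hz
        rw [mem_closedBall_zero_iff, dslope_of_ne _ hz0, slope_def_field, h0, sub_zero, sub_zero,
          norm_div, div_le_iff₀ (norm_pos_iff.2 hz0)]
        exact hle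
  obtain ⟨a, ha⟩ := hd.exists_const_forall_eq_of_bounded hb
  refine ⟨a, fun z => ?_⟩
  rcases eq_or_ne z 0 with rfl | hz0
  · rw [h0, mul_zero]
  · rw [← ha z, dslope_of_ne _ hz0, slope_def_field, h0, sub_zero, sub_zero, div_mul_cancel₀ _ hz0]

theorem exists_mobius_of_mem_holomorphicAut_complex {f : Equiv.Perm ℂ}
    (hf : f ∈ holomorphicAut ℂ) :
    ∃ a b c d : ℂ, a * d - b * c ≠ 0 ∧ ∀ z : ℂ, f z * (c * z + d) = a * z + b := by
  have hmem : f.trans (Equiv.subRight (f 0)) ∈ holomorphicAut ℂ := by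
    refine ⟨Differentiable.mdifferentiable ?_, Differentiable.mdifferentiable ?_⟩
    · exact hf.1.differentiable.sub_const (f 0)
    · exact hf.2.differentiable.comp (differentiable_id.add_const (f 0))
  obtain ⟨a, ha⟩ := exists_eq_mul_of_mem_holomorphicAut_of_map_zero hmem (by simp)
  have ha' : ∀ z, f z = a * z + f 0 := fun z => by
    have h : f z - f 0 = a * z := ha z
    rw [← h, sub_add_cancel]
  refine ⟨a, f 0, 0, 1, ?_, fun z => by rw [ha' z]; ring⟩
  intro h
  have h1 : a = 0 := by simpa using h
  have h2 : f 1 = f 0 := by rw [ha' 1, h1]; ring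
  exact one_ne_zero (f.injective h2)

/-! ### From Möbius groups to matrix groups -/

section Mobius

open scoped MatrixGroups

variable {X : Type*}

/-- The pairs of a matrix of determinant one and a permutation of `X` such that, in the coordinate
`ι`, the permutation is the Möbius transformation given by the matrix. -/
def mobiusPairs (ι : X → ℂ) : Subgroup (SL(2, ℂ) × Equiv.Perm X) where
  carrier := {g | ∀ x, ι (g.2 x) * (g.1 1 0 * ι x + g.1 1 1) = g.1 0 0 * ι x + g.1 0 1}
  one_mem' x := by simp
  mul_mem' {g h} hg hh x := by
    have h1 := hh x
    have h2 := hg (h.2 x)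
    have hdet : g.1 0 0 * g.1 1 1 - g.1 0 1 * g.1 1 0 = 1 := by
      rw [← Matrix.det_fin_two]; exact g.1.2
    simp only [Prod.fst_mul, Prod.snd_mul, Equiv.Perm.mul_apply, Matrix.SpecialLinearGroup.coe_mul,
      Matrix.mul_apply, Fin.sum_univ_two]
    linear_combination (h.1 1 0 * ι x + h.1 1 1) * h2 +
      (g.1 0 0 - g.1 1 0 * ι (g.2 (h.2 x))) * h1
  inv_mem' {g} hg x := by
    have h1 := hg (g.2.symm x)
    rw [Equiv.apply_symm_apply] at h1
    simp only [Prod.fst_inv, Prod.snd_inv, Equiv.Perm.inv_def, Matrix.SpecialLinearGroup.SL2_inv_expl]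
    simp
    linear_combination -h1

theorem exists_mem_mobiusPairs {ι : X → ℂ} {f : Equiv.Perm X} {a b c d : ℂ}
    (hdet : a * d - b * c ≠ 0) (h : ∀ x, ι (f x) * (c * ι x + d) = a * ι x + b) :
    ∃ M : SL(2, ℂ), (M, f) ∈ mobiusPairs ι := by
  obtain ⟨s, hs⟩ := IsAlgClosed.exists_pow_nat_eq (a * d - b * c) (n := 2) two_pos
  have hs0 : s ≠ 0 := by rintro rfl; exact hdet (by rw [← hs]; simp)
  refine ⟨⟨!![a / s, b / s; c / s, d / s], ?_⟩, fun x => ?_⟩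
  · rw [Matrix.det_fin_two_of]
    field_simp
    exact hs.symm
  · simp
    field_simp
    linear_combination h x

/-- A matrix of determinant one inducing the identity has square one. -/
theorem sq_eq_one_of_mem_mobiusPairs {ι : X → ℂ} (hι : (Set.range ι).Infinite) {M : SL(2, ℂ)}
    (h : (M, 1) ∈ mobiusPairs ι) : M ^ 2 = 1 := by
  -- The fixed-point equation is a quadratic in `ι x`; three distinct roots make it vanish, so `M`
  -- is scalar.
  obtain ⟨_, ⟨⟨x, rfl⟩, -⟩⟩ := hι.exists_notMem_finset ∅
  obtain ⟨_, ⟨⟨y, rfl⟩, hy⟩⟩ := hι.exists_notMem_finset {ι x}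
  obtain ⟨_, ⟨⟨z, rfl⟩, hz⟩⟩ := hι.exists_notMem_finset {ι x, ι y}
  simp only [Finset.mem_singleton, Finset.mem_insert, not_or] at hy hz
  have hx1 := h x
  have hy1 := h y
  have hz1 := h z
  simp only [Equiv.Perm.one_apply] at hx1 hy1 hz1
  have hxy : M 1 0 * (ι y + ι x) + M 1 1 - M 0 0 = 0 :=
    mul_left_cancel₀ (sub_ne_zero.2 hy) (by linear_combination hy1 - hx1)
  have hxz : M 1 0 * (ι z + ι x) + M 1 1 - M 0 0 = 0 :=
    mul_left_cancel₀ (sub_ne_zero.2 hz.1) (by linear_combination hz1 - hx1)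
  have hc : M 1 0 = 0 :=
    mul_right_cancel₀ (sub_ne_zero.2 hz.2) (by linear_combination hxz - hxy)
  have had : M 1 1 = M 0 0 := by linear_combination hxy - (ι y + ι x) * hc
  have hb : M 0 1 = 0 := by linear_combination (ι x) ^ 2 * hc + ι x * had - hx1
  have hdet : M 0 0 * M 1 1 - M 0 1 * M 1 0 = 1 := by
    rw [← Matrix.det_fin_two]; exact M.2
  rw [hb, had] at hdet
  ext i j
  rw [sq, Matrix.SpecialLinearGroup.coe_mul, Matrix.mul_apply, Fin.sum_univ_two]
  fin_cases i <;> fin_cases j <;> simp [hc, hb, had] <;> linear_combination hdet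

theorem eq_one_of_one_mem_mobiusPairs {ι : X → ℂ} (hι : Function.Injective ι) {f : Equiv.Perm X}
    (h : (1, f) ∈ mobiusPairs ι) : f = 1 := by
  ext x
  exact hι (by simpa using h x)

/-- A finitely generated group of Möbius transformations is virtually torsion-free. -/
theorem exists_torsionFree_of_mobius {ι : X → ℂ} (hι : Function.Injective ι)
    (hinf : (Set.range ι).Infinite) {Γ : Subgroup (Equiv.Perm X)} (hfg : Γ.FG)
    (hΓ : ∀ f ∈ Γ, ∃ M : SL(2, ℂ), (M, f) ∈ mobiusPairs ι) :
    ∃ N : Subgroup Γ, N.Normal ∧ N.FiniteIndex ∧ IsTorsionFreeSubgroup N := by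
  obtain ⟨S, hS⟩ := hfg
  choose! L hL using hΓ
  have hSΓ : (S : Set (Equiv.Perm X)) ⊆ Γ := by rw [← hS]; exact Subgroup.subset_closure
  -- Lifting only the generators keeps `H` finitely generated; the chosen lift `L` need not be a
  -- homomorphism.
  let H : Subgroup (SL(2, ℂ) × Equiv.Perm X) :=
    Subgroup.closure ((fun f => (L f, f)) '' (S : Set (Equiv.Perm X)))
  have hHm : H ≤ mobiusPairs ι := by
    rw [Subgroup.closure_le]
    rintro _ ⟨f, hf, rfl⟩
    exact hL f (hSΓ hf)
  have hHmap : H.map (MonoidHom.snd _ _) = Γ := by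
    rw [MonoidHom.map_closure, ← Set.image_comp, ← hS]
    simp [Function.comp_def]
  have hHfg : Group.FG H := by
    rw [Group.fg_iff_subgroup_fg, Subgroup.fg_iff]
    exact ⟨_, rfl, S.finite_toSet.image _⟩
  let ρ : H →* SL(2, ℂ) := (MonoidHom.fst _ _).comp H.subtype
  let π : H →* Γ := ((MonoidHom.snd _ _).comp H.subtype).codRestrict Γ fun x => by
    rw [← hHmap]; exact ⟨x, x.2, rfl⟩
  have hπ : Function.Surjective π := by
    rintro ⟨f, hf⟩
    rw [← hHmap] at hf
    obtain ⟨x, hx, rfl⟩ := hf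
    exact ⟨⟨x, hx⟩, rfl⟩
  have hmem : ∀ x : H, (ρ x, (π x : Equiv.Perm X)) ∈ mobiusPairs ι := fun x => hHm x.2
  obtain ⟨N, hN, hNf, hNt⟩ := exists_normal_finiteIndex_of_fg
    (Matrix.SpecialLinearGroup.coeMonoidHom.comp ρ)
  refine ⟨N.map π, hN.map π hπ, ?_, ?_⟩
  · refine ⟨fun h0 => hNf.index_ne_zero ?_⟩
    exact Nat.eq_zero_of_zero_dvd (h0 ▸ Subgroup.index_map_dvd N hπ)
  · rintro _ ⟨y, hy, rfl⟩ hfin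
    obtain ⟨k, hk, hpow⟩ := isOfFinOrder_iff_pow_eq_one.1 hfin
    -- `ρ y ^ k` induces the identity, so `ρ y ^ (2k) = 1`; Selberg's lemma gives `ρ y = 1`, whence
    -- `π y = 1`.
    have h1 := hmem (y ^ k)
    rw [map_pow π, hpow] at h1
    have h2 := sq_eq_one_of_mem_mobiusPairs hinf h1
    rw [map_pow, ← pow_mul] at h2
    have h3 := hNt y hy (isOfFinOrder_iff_pow_eq_one.2 ⟨k * 2, by positivity, by
      rw [MonoidHom.comp_apply, ← map_pow, h2, map_one]⟩)
    have h4 : ρ y = 1 := Subtype.ext h3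
    have h5 := hmem y
    rw [h4] at h5
    exact Subtype.ext (eq_one_of_one_mem_mobiusPairs hι h5)

end Mobius

/-! ### The compact case and the conclusion -/

/-- Every translate of the compact set `X` meets `X`, and proper discontinuity allows this for only
finitely many elements. -/
theorem IsCocompactDiscontinuous.finite_of_compactSpace {X : Type*} [TopologicalSpace X]
    [ChartedSpace ℂ X] [CompactSpace X] [Nonempty X] {Γ : Subgroup (Equiv.Perm X)}
    (hΓ : IsCocompactDiscontinuous Γ) : Finite Γ := by
  have := hΓ.properlyDiscontinuous
  have h := finite_disjoint_inter_image (Γ := Γ) (isCompact_univ (X := X)) (isCompact_univ (X := X))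
  refine Set.finite_univ_iff.1 (h.subset fun γ _ => ?_)
  simpa using! Set.range_nonempty _

theorem IsTorsionFreeSubgroup.exists_of_mulEquiv {G G' : Type*} [Group G] [Group G'] (e : G ≃* G')
    (h : ∃ N : Subgroup G', N.Normal ∧ N.FiniteIndex ∧ IsTorsionFreeSubgroup N) :
    ∃ N : Subgroup G, N.Normal ∧ N.FiniteIndex ∧ IsTorsionFreeSubgroup N := by
  obtain ⟨N, hN, hNf, hNt⟩ := h
  refine ⟨N.comap e.toMonoidHom, inferInstance, ?_, fun x hx hfin => ?_⟩
  · refine ⟨?_⟩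
    rw [N.index_comap_of_surjective (f := e.toMonoidHom) e.surjective]
    exact hNf.index_ne_zero
  · exact (map_eq_one_iff e e.injective).1 (hNt _ hx (e.toMonoidHom.isOfFinOrder hfin))

theorem proposition3 (G : Type*) [Group G] (hG : IsFuchsianGroup G) :
    ∃ N : Subgroup G, N.Normal ∧ N.FiniteIndex ∧ IsTorsionFreeSubgroup N := by
  rcases hG with ⟨Γ, hΓ, ⟨e⟩⟩ | ⟨Γ, hΓ, ⟨e⟩⟩ | ⟨Γ, hΓ, ⟨e⟩⟩
  · have := hΓ.finite_of_compactSpace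
    have : Finite G := Finite.of_equiv Γ e.symm
    exact ⟨⊥, inferInstance, inferInstance, fun x hx _ => Subgroup.mem_bot.1 hx⟩
  · refine IsTorsionFreeSubgroup.exists_of_mulEquiv e
      (exists_torsionFree_of_mobius (ι := id) Function.injective_id ?_ hΓ.fg fun f hf => ?_)
    · rw [Set.range_id]; exact Set.infinite_univ
    · obtain ⟨a, b, c, d, hdet, h⟩ := exists_mobius_of_mem_holomorphicAut_complex (hΓ.le_aut hf)
      exact exists_mem_mobiusPairs hdet h
  · refine IsTorsionFreeSubgroup.exists_of_mulEquiv e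
      (exists_torsionFree_of_mobius (ι := ((↑) : UpperHalfPlane → ℂ)) UpperHalfPlane.coe_injective
        ?_ hΓ.fg fun f hf => ?_)
    · refine Set.infinite_of_injective_forall_mem (f := fun n : ℕ => ((n : ℂ) + Complex.I)) ?_
        fun n => ⟨⟨(n : ℂ) + Complex.I, by simp⟩, rfl⟩
      intro m n h
      simpa using h
    · obtain ⟨a, b, c, d, hdet, h⟩ :=
        exists_mobius_of_mem_holomorphicAut_upperHalfPlane (hΓ.le_aut hf)
      exact exists_mem_mobiusPairs hdet h
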